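/- Let $V$ be the node set of a complete graph with $n\ge 1$ nodes. Each node is in one of three states: agnostic (no colour), red, or blue; red and blue nodes are called gnostic. Consider the asynchronous pull voter model with agnostic nodes: in each round, independently of the past, a node $v$ is chosen uniformly at random from $V$, and $v$ selects a node $u$ uniformly at random from the other $n-1$ nodes (if $n=1$, nothing happens). If $u$ is agnostic, no state changes; if $u$ is gnostic, $v$ adopts the colour of $u$. Let $S_t\in\{\text{agnostic},\text{red},\text{blue}\}^V$ be the configuration after $t$ rounds. Fix an initial configuration $S_0$ with at least one gnostic node, and let $$\gamma=\frac{|\{v : S_0(v)=\text{red}\}|}{|\{v : S_0(v)\in\{\text{red},\text{blue}\}\}|}.$$ For $u\in V$ let $R(u)$ be the event that $u$ is gnostic at some time and is red at the first time at which it is gnostic. Then $$\mathbb P(R(u)\mid S_0)=\gamma\qquad\text{for every node } u \text{ that is agnostic in } S_0,$$ and $$\mathbb P(\text{red wins}\mid S_0)=\gamma,$$ where red wins if $S_t(v)=\text{red}$ for all $v\in V$ at some time $t\ge 0$. -/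

import Mathlib

namespace AgnosticVoter

/-- The state of a node: without a colour (agnostic), or with one of the two colours (gnostic). -/
inductive Opinion
  | agnostic
  | red
  | blue
  deriving DecidableEq

/-- One pull: node `v` has selected node `u`. It copies the colour of `u` if `u` is gnostic,
and nothing happens if `u` is agnostic. -/
def pull {V : Type*} [DecidableEq V] (s : V → Opinion) (v u : V) : V → Opinion :=
  if s u = Opinion.agnostic then s else Function.update s v (s u)

/-- Uniform selection of a neighbour of `v` in the graph `G`. Each row of selection weights must
sum to one, so a node without neighbours gets a loop of weight one; this occurs in a complete
graph only if it has a single node. -/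
noncomputable def neighbourLaw {V : Type*} [Fintype V] (G : SimpleGraph V) [DecidableRel G.Adj]
    (v : V) : PMF V :=
  if h : (G.neighborFinset v).Nonempty then PMF.uniformOfFinset (G.neighborFinset v) h
  else PMF.pure v

/-- The law of the pair `(v, u)` in an asynchronous round: the acting node `v` is uniform among
all nodes, and given `v`, the selected node `u` is a uniform neighbour of `v`. -/
noncomputable def selectionLaw {V : Type*} [Fintype V] [Nonempty V] (G : SimpleGraph V)
    [DecidableRel G.Adj] : PMF (V × V) :=
  (PMF.uniformOfFintype V).bind fun v => (neighbourLaw G v).map fun u => (v, u)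

/-- The probability measure of the asynchronous process on sequences of selections: the
selections of the rounds `0, 1, 2, …` are independent, each with law `selectionLaw G`. -/
noncomputable def asyncMeasure {V : Type*} [Fintype V] [Nonempty V] [MeasurableSpace V]
    (G : SimpleGraph V) [DecidableRel G.Adj] : MeasureTheory.Measure (ℕ → V × V) :=
  MeasureTheory.Measure.infinitePi fun _ : ℕ => (selectionLaw G).toMeasure

/-- The configuration `S_t` after `t` rounds of the asynchronous pull voter model with agnostic
nodes, started in `s₀`, as a function of the sequence `ω` of selections. -/
def state {V : Type*} [DecidableEq V] (s₀ : V → Opinion) (ω : ℕ → V × V) : ℕ → V → Opinion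
  | 0 => s₀
  | t + 1 => pull (state s₀ ω t) (ω t).1 (ω t).2

/-- The event `R(u)`: node `u` becomes gnostic, and the first colour it has is red. -/
def becomesRed {V : Type*} [DecidableEq V] (s₀ : V → Opinion) (u : V) : Set (ℕ → V × V) :=
  {ω | ∃ t, state s₀ ω t u = Opinion.red ∧ ∀ i < t, state s₀ ω i u = Opinion.agnostic}

/-- The event that red wins: a configuration in which all nodes are red is reached. -/
def redWins {V : Type*} [DecidableEq V] (s₀ : V → Opinion) : Set (ℕ → V × V) :=
  {ω | ∃ t, ∀ v, state s₀ ω t v = Opinion.red}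

/-- The proportion of red nodes among the gnostic ones. -/
noncomputable def redFraction {V : Type*} [Fintype V] (s : V → Opinion) : ℝ :=
  ((Finset.univ.filter fun v => s v = Opinion.red).card : ℝ) /
    ((Finset.univ.filter fun v => s v ≠ Opinion.agnostic).card : ℝ)

end AgnosticVoter

/-!
Both events are absorption events of a finite Markov chain on configurations, so their
probabilities are harmonic functions of the initial configuration (condition on the first round),
and by the maximum principle a harmonic function is determined by its values on a set that can be
reached from every configuration. It remains to see that the proportion `γ` of red nodes among the
gnostic ones is harmonic. If an agnostic node acts, the expected change of `γ` vanishes because the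
mean over the gnostic nodes `u` of the indicator that `u` is red is `γ`. If a gnostic node `v` pulls
from a gnostic node `u`, the change is antisymmetric in `u` and `v`. For the first colour of `w`,
the candidate is `γ` as long as `w` is agnostic, and the indicator that `w` is red afterwards.
-/

namespace AgnosticVoter

open MeasureTheory ProbabilityTheory Relation

section Harmonic

variable {α β : Type*} [MeasurableSpace β]

/-- Harmonicity at `x` for the Markov chain that moves from `x` to `F x b`, where the innovation
`b` has law `ν`. -/
def IsHarmonicAt (ν : Measure β) (F : α → β → α) (f : α → ℝ) (x : α) : Prop :=
  f x = ∫ b, f (F x b) ∂ν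

/-- The transition graph of the chain with update rule `F` and innovation law `ν`; only
innovations that are atoms of `ν` count. -/
def CanStep (ν : Measure β) (F : α → β → α) (x y : α) : Prop :=
  ∃ b, ν {b} ≠ 0 ∧ F x b = y

variable [DiscreteMeasurableSpace β] {ν : Measure β} {F : α → β → α} {A : Set α} {f g : α → ℝ}

lemma integrable_comp_of_finite [Finite α] [IsFiniteMeasure ν] (f : α → ℝ) (X : β → α) :
    Integrable (fun b => f (X b)) ν := by
  obtain ⟨C, hC⟩ := (Set.finite_range fun x => ‖f x‖).bddAbove
  exact .of_bound Measurable.of_discrete.aestronglyMeasurable C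
    (.of_forall fun b => hC ⟨X b, rfl⟩)

variable [Finite α] [IsProbabilityMeasure ν]

lemma IsHarmonicAt.eq_of_canStep {x y : α} (hx : IsHarmonicAt ν F f x) (hxy : CanStep ν F x y)
    (hmax : ∀ z, f z ≤ f x) : f y = f x := by
  obtain ⟨b, hb, rfl⟩ := hxy
  have hae : (fun b => f (F x b)) =ᵐ[ν] fun _ => f x := by
    rw [← integral_eq_iff_of_ae_le (integrable_comp_of_finite f (F x)) (integrable_const _)
      (.of_forall fun b => hmax (F x b)), ← (hx : f x = _), integral_const, probReal_univ,
      one_smul]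
  by_contra hne
  exact hb (measure_mono_null (Set.singleton_subset_iff.2 hne) hae)

theorem le_of_isHarmonicAt (hA : ∀ x, ∃ a ∈ A, ReflTransGen (CanStep ν F) x a)
    (hf : ∀ x ∉ A, IsHarmonicAt ν F f x) {c : ℝ} (hc : ∀ a ∈ A, f a ≤ c) (x : α) : f x ≤ c := by
  have : Nonempty α := ⟨x⟩
  obtain ⟨m, hm⟩ := Finite.exists_max f
  obtain ⟨a, ha, hpath⟩ := hA m
  suffices ∀ y, ReflTransGen (CanStep ν F) y a → f y = f m → f m ≤ c from
    (hm x).trans (this m hpath rfl)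
  intro y hy
  induction hy using ReflTransGen.head_induction_on with
  | refl => exact fun h => h ▸ hc a ha
  | @head y z hstep _ ih =>
    intro h
    by_cases hyA : y ∈ A
    · exact h ▸ hc y hyA
    · exact ih (((hf y hyA).eq_of_canStep hstep (h ▸ hm)).trans h)

lemma IsHarmonicAt.sub {x : α} (hf : IsHarmonicAt ν F f x) (hg : IsHarmonicAt ν F g x) :
    IsHarmonicAt ν F (f - g) x := by
  rw [IsHarmonicAt] at hf hg ⊢
  rw [Pi.sub_apply, hf, hg]
  exact (integral_sub (integrable_comp_of_finite f _) (integrable_comp_of_finite g _)).symm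

theorem eq_of_isHarmonicAt_of_eqOn (hA : ∀ x, ∃ a ∈ A, ReflTransGen (CanStep ν F) x a)
    (hf : ∀ x ∉ A, IsHarmonicAt ν F f x) (hg : ∀ x ∉ A, IsHarmonicAt ν F g x)
    (hfg : Set.EqOn f g A) : f = g := by
  funext x
  refine le_antisymm (sub_nonpos.1 ?_) (sub_nonpos.1 ?_)
  · exact le_of_isHarmonicAt hA (fun y hy => (hf y hy).sub (hg y hy))
      (fun a ha => (sub_eq_zero.2 (hfg ha)).le) x
  · exact le_of_isHarmonicAt hA (fun y hy => (hg y hy).sub (hf y hy))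
      (fun a ha => (sub_eq_zero.2 (hfg ha).symm).le) x

end Harmonic

section FirstStep

variable {β : Type*}

/-- The sequence `b, ω 0, ω 1, …`, used to split off the first round. -/
def prepend (b : β) (ω : ℕ → β) : ℕ → β
  | 0 => b
  | t + 1 => ω t

lemma prepend_preimage_pi (s : Finset ℕ) (B : ℕ → Set β) :
    (fun q : β × (ℕ → β) => prepend q.1 q.2) ⁻¹' (s : Set ℕ).pi B =
      {b | 0 ∈ s → b ∈ B 0} ×ˢ
        (s.preimage Nat.succ Nat.succ_injective.injOn : Set ℕ).pi fun t => B (t + 1) := by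
  ext ⟨b, ω⟩
  simp only [Set.mem_preimage, Set.mem_pi, Set.mem_prod]
  refine ⟨fun h => ⟨h 0, fun t ht => h (t + 1) (by simpa using ht)⟩, fun h t ht => ?_⟩
  cases t with
  | zero => exact h.1 ht
  | succ t => exact h.2 t (by simpa using ht)

variable [MeasurableSpace β]

lemma measurable_prepend : Measurable fun q : β × (ℕ → β) => prepend q.1 q.2 := by
  refine measurable_pi_iff.2 fun t => ?_
  cases t with
  | zero => exact measurable_fst
  | succ t => exact (measurable_pi_apply t).comp measurable_snd

lemma measurePreserving_prepend (ν : Measure β) [IsProbabilityMeasure ν] :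
    MeasurePreserving (fun q : β × (ℕ → β) => prepend q.1 q.2)
      (ν.prod (Measure.infinitePi fun _ : ℕ => ν)) (Measure.infinitePi fun _ : ℕ => ν) := by
  classical
  refine ⟨measurable_prepend, Measure.eq_infinitePi _ fun s B hB => ?_⟩
  have hzero : ν {b | 0 ∈ s → b ∈ B 0} = ∏ t ∈ s with t ∉ Set.range Nat.succ, ν (B t) := by
    by_cases h : 0 ∈ s
    · have : s.filter (· ∉ Set.range Nat.succ) = {0} := by
        ext t; cases t <;> simp [h]
      rw [this, Finset.prod_singleton]
      simp [h]
    · have : s.filter (· ∉ Set.range Nat.succ) = ∅ := by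
        ext t; cases t <;> simp [h]
      rw [this, Finset.prod_empty]
      simp [h]
  rw [Measure.map_apply measurable_prepend (.pi s.countable_toSet fun t _ => hB t),
    prepend_preimage_pi, Measure.prod_prod, Measure.infinitePi_pi _ fun t _ => hB (t + 1), hzero,
    Finset.prod_preimage' Nat.succ s Nat.succ_injective.injOn fun t => ν (B t), mul_comm,
    Finset.prod_filter_mul_prod_filter_not]

theorem infinitePi_real_eq_integral_prepend (ν : Measure β) [IsProbabilityMeasure ν]
    {E : Set (ℕ → β)} (hE : MeasurableSet E) :
    (Measure.infinitePi fun _ : ℕ => ν).real E =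
      ∫ b, (Measure.infinitePi fun _ : ℕ => ν).real {ω | prepend b ω ∈ E} ∂ν := by
  have hE' := measurable_prepend hE
  rw [← (measurePreserving_prepend ν).measureReal_preimage hE.nullMeasurableSet, measureReal_def,
    Measure.prod_apply hE', ← integral_toReal (measurable_measure_prodMk_left hE').aemeasurable
      (.of_forall fun _ => measure_lt_top _ _)]
  rfl

theorem isHarmonicAt_infinitePi_real {α : Type*} {ν : Measure β} [IsProbabilityMeasure ν]
    {F : α → β → α} {E : α → Set (ℕ → β)} {x : α} (hE : MeasurableSet (E x))
    (hx : ∀ b ω, prepend b ω ∈ E x ↔ ω ∈ E (F x b)) :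
    IsHarmonicAt ν F (fun y => (Measure.infinitePi fun _ : ℕ => ν).real (E y)) x := by
  rw [IsHarmonicAt, infinitePi_real_eq_integral_prepend ν hE]
  simp only [hx, Set.ofPred_mem_eq]

end FirstStep

section RedFraction

variable {V : Type*} [Fintype V] {s : V → Opinion} {v : V}

/-- The set of nodes that have a colour. -/
def gnostic (s : V → Opinion) : Finset V :=
  {v | s v ≠ .agnostic}

/-- The indicator of the colour red; its average over the gnostic nodes is `redFraction`. -/
def redIndicator (c : Opinion) : ℝ :=
  if c = .red then 1 else 0

@[simp]
lemma mem_gnostic : v ∈ gnostic s ↔ s v ≠ .agnostic := by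
  simp [gnostic]

lemma redFraction_eq_sum_div (s : V → Opinion) :
    redFraction s = (∑ v ∈ gnostic s, redIndicator (s v)) / (gnostic s).card := by
  rw [redFraction, gnostic, Finset.card_filter, Finset.sum_filter]
  push_cast
  congr 1
  refine Finset.sum_congr rfl fun v _ => ?_
  cases s v <;> simp [redIndicator]

lemma card_gnostic_mul_redFraction (s : V → Opinion) :
    (gnostic s).card * redFraction s = ∑ v ∈ gnostic s, redIndicator (s v) := by
  rw [redFraction_eq_sum_div]
  refine mul_div_cancel_of_imp' fun h => ?_
  rw [Finset.card_eq_zero.1 (Nat.cast_eq_zero.1 h), Finset.sum_empty]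

lemma sum_redIndicator_sub_redFraction (s : V → Opinion) :
    ∑ u ∈ gnostic s, (redIndicator (s u) - redFraction s) = 0 := by
  rw [Finset.sum_sub_distrib, Finset.sum_const, nsmul_eq_mul, card_gnostic_mul_redFraction,
    sub_self]

lemma redFraction_const (c : Opinion) [Nonempty V] :
    redFraction (Function.const V c) = redIndicator c := by
  cases c <;> simp [redFraction, redIndicator]

variable [DecidableEq V] {c : Opinion}

lemma gnostic_update (hc : c ≠ .agnostic) :
    gnostic (Function.update s v c) = insert v (gnostic s) := by
  ext u
  rcases eq_or_ne u v with rfl | h <;> simp [*]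

lemma redFraction_update_of_agnostic (hv : s v = .agnostic) (hc : c ≠ .agnostic) :
    redFraction (Function.update s v c) - redFraction s =
      (redIndicator c - redFraction s) / ((gnostic s).card + 1) := by
  have hmem : v ∉ gnostic s := by simp [hv]
  have hsum : ∑ u ∈ gnostic s, redIndicator (Function.update s v c u) =
      (gnostic s).card * redFraction s := by
    rw [card_gnostic_mul_redFraction]
    refine Finset.sum_congr rfl fun u hu => ?_
    rw [Function.update_of_ne (ne_of_mem_of_not_mem hu hmem)]
  have hcard : ((gnostic s).card + 1 : ℝ) ≠ 0 := by positivity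
  rw [redFraction_eq_sum_div (Function.update s v c), gnostic_update hc, Finset.sum_insert hmem,
    Finset.card_insert_of_notMem hmem, Function.update_self, hsum]
  push_cast
  field_simp
  ring

lemma redFraction_update_of_gnostic (hv : s v ≠ .agnostic) (hc : c ≠ .agnostic) :
    redFraction (Function.update s v c) - redFraction s =
      (redIndicator c - redIndicator (s v)) / (gnostic s).card := by
  have hmem : v ∈ gnostic s := mem_gnostic.2 hv
  have hsum : ∑ u ∈ (gnostic s).erase v, redIndicator (Function.update s v c u) =
      ∑ u ∈ (gnostic s).erase v, redIndicator (s u) :=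
    Finset.sum_congr rfl fun u hu => by rw [Function.update_of_ne (Finset.ne_of_mem_erase hu)]
  rw [redFraction_eq_sum_div, redFraction_eq_sum_div, gnostic_update hc,
    Finset.insert_eq_of_mem hmem, ← sub_div, ← Finset.add_sum_erase _ _ hmem,
    ← Finset.add_sum_erase _ (fun u => redIndicator (s u)) hmem, Function.update_self, hsum,
    add_sub_add_right_eq_sub]

end RedFraction

section Pull

variable {V : Type*} [DecidableEq V] {s : V → Opinion} {u v : V}

lemma pull_of_agnostic (hu : s u = .agnostic) : pull s v u = s :=
  if_pos hu

lemma pull_of_gnostic (hu : s u ≠ .agnostic) : pull s v u = Function.update s v (s u) :=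
  if_neg hu

@[simp]
lemma pull_self (s : V → Opinion) (v : V) : pull s v v = s := by
  simp [pull]

@[simp]
lemma pull_const (c : Opinion) (v u : V) : pull (Function.const V c) v u = Function.const V c := by
  unfold pull
  split_ifs
  · rfl
  · exact Function.update_eq_self v (Function.const V c)

lemma pull_apply_of_ne {w : V} (h : w ≠ v) : pull s v u w = s w := by
  unfold pull
  split_ifs
  · rfl
  · exact Function.update_of_ne h _ _

variable [Fintype V]

lemma sum_pull_sub (f : (V → Opinion) → ℝ) (s : V → Opinion) (v : V) :
    ∑ u, (f (pull s v u) - f s) =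
      ∑ u ∈ gnostic s, (f (Function.update s v (s u)) - f s) := by
  rw [gnostic, Finset.sum_filter]
  refine Finset.sum_congr rfl fun u _ => ?_
  split_ifs with hu
  · rw [pull_of_gnostic hu]
  · rw [pull_of_agnostic (not_not.1 hu), sub_self]

lemma sum_redFraction_pull_of_agnostic (hv : s v = .agnostic) :
    ∑ u, (redFraction (pull s v u) - redFraction s) = 0 := by
  rw [sum_pull_sub, Finset.sum_congr rfl fun u hu =>
    redFraction_update_of_agnostic hv (mem_gnostic.1 hu), ← Finset.sum_div,
    sum_redIndicator_sub_redFraction, zero_div]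

lemma sum_redFraction_pull_of_gnostic (hv : s v ≠ .agnostic) :
    ∑ u, (redFraction (pull s v u) - redFraction s) =
      ∑ u ∈ gnostic s, (redIndicator (s u) - redIndicator (s v)) / (gnostic s).card := by
  rw [sum_pull_sub]
  exact Finset.sum_congr rfl fun u hu => redFraction_update_of_gnostic hv (mem_gnostic.1 hu)

lemma sum_sum_redFraction_pull (s : V → Opinion) :
    ∑ v, ∑ u, (redFraction (pull s v u) - redFraction s) = 0 := by
  -- `v` pulling from `u` and `u` pulling from `v` have opposite drifts if both are gnostic.
  have hgnostic : ∑ v ∈ gnostic s, ∑ u, (redFraction (pull s v u) - redFraction s) = 0 := by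
    rw [Finset.sum_congr rfl fun v hv => sum_redFraction_pull_of_gnostic (mem_gnostic.1 hv)]
    simp only [← Finset.sum_div, Finset.sum_sub_distrib, Finset.sum_const, ← Finset.smul_sum,
      sub_self, zero_div]
  rw [← hgnostic, eq_comm]
  refine Finset.sum_subset (Finset.subset_univ _) fun v _ hv => ?_
  exact sum_redFraction_pull_of_agnostic (by simpa using hv)

/-- The probability that the first colour of `w` is red, as a function of the configuration. -/
noncomputable def firstRedProb (w : V) (s : V → Opinion) : ℝ :=
  if s w = .agnostic then redFraction s else redIndicator (s w)

lemma sum_firstRedProb_pull_self {w : V} (hw : s w = .agnostic) :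
    ∑ u, (firstRedProb w (pull s w u) - firstRedProb w s) = 0 := by
  rw [sum_pull_sub, ← sum_redIndicator_sub_redFraction s]
  refine Finset.sum_congr rfl fun u hu => ?_
  rw [firstRedProb, firstRedProb, Function.update_self, if_neg (mem_gnostic.1 hu), if_pos hw]

lemma sum_sum_firstRedProb_pull {w : V} (hw : s w = .agnostic) :
    ∑ v, ∑ u, (firstRedProb w (pull s v u) - firstRedProb w s) = 0 := by
  rw [← sum_sum_redFraction_pull s]
  refine Finset.sum_congr rfl fun v _ => ?_
  rcases eq_or_ne w v with rfl | h
  · rw [sum_firstRedProb_pull_self hw, sum_redFraction_pull_of_agnostic hw]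
  · simp only [firstRedProb, pull_apply_of_ne h, hw, if_true]

end Pull

section Selection

variable {V : Type*} [Fintype V] {u v : V}

lemma neighbourLaw_apply_of_adj (G : SimpleGraph V) [DecidableRel G.Adj] (h : G.Adj v u) :
    neighbourLaw G v u = (G.degree v : ENNReal)⁻¹ := by
  have hu : u ∈ G.neighborFinset v := (G.mem_neighborFinset v u).2 h
  have hne : (G.neighborFinset v).Nonempty := ⟨u, hu⟩
  rw [neighbourLaw, dif_pos hne, PMF.uniformOfFinset_apply_of_mem hne hu,
    SimpleGraph.card_neighborFinset_eq_degree]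

variable [Nonempty V]

lemma selectionLaw_apply (G : SimpleGraph V) [DecidableRel G.Adj] (v u : V) :
    selectionLaw G (v, u) = (Fintype.card V : ENNReal)⁻¹ * neighbourLaw G v u := by
  classical
  simp [selectionLaw, PMF.bind_apply, PMF.map_apply, tsum_fintype, ite_and]

variable [DecidableEq V]

lemma selectionLaw_top_apply_of_ne (h : v ≠ u) :
    selectionLaw (⊤ : SimpleGraph V) (v, u) =
      (Fintype.card V : ENNReal)⁻¹ * ((Fintype.card V - 1 : ℕ) : ENNReal)⁻¹ := by
  rw [selectionLaw_apply, neighbourLaw_apply_of_adj _ ((SimpleGraph.top_adj v u).2 h),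
    SimpleGraph.complete_graph_degree]

variable [MeasurableSpace V] [DiscreteMeasurableSpace V]

lemma integral_selectionLaw_top {f : V × V → ℝ} (hf : ∀ v, f (v, v) = 0) :
    ∫ q, f q ∂(selectionLaw (⊤ : SimpleGraph V)).toMeasure =
      ((Fintype.card V : ℝ)⁻¹ * ((Fintype.card V - 1 : ℕ) : ℝ)⁻¹) * ∑ v, ∑ u, f (v, u) := by
  rw [PMF.integral_eq_sum, Fintype.sum_prod_type]
  simp only [Finset.mul_sum]
  refine Finset.sum_congr rfl fun v _ => Finset.sum_congr rfl fun u _ => ?_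
  rcases eq_or_ne v u with rfl | h
  · simp [hf]
  · rw [selectionLaw_top_apply_of_ne h, ENNReal.toReal_mul, ENNReal.toReal_inv,
      ENNReal.toReal_inv, ENNReal.toReal_natCast, ENNReal.toReal_natCast, smul_eq_mul]

lemma selectionLaw_top_singleton_ne_zero (h : v ≠ u) :
    (selectionLaw (⊤ : SimpleGraph V)).toMeasure {(v, u)} ≠ 0 := by
  rw [PMF.toMeasure_apply_singleton _ _ (measurableSet_singleton _),
    selectionLaw_top_apply_of_ne h]
  simp

end Selection

instance : Fintype Opinion where
  elems := {.agnostic, .red, .blue}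
  complete c := by cases c <;> simp

instance : MeasurableSpace Opinion := ⊤

instance : DiscreteMeasurableSpace Opinion := ⟨fun _ => trivial⟩

section CompleteGraph

variable {V : Type*} [Fintype V] [DecidableEq V] [Nonempty V] [MeasurableSpace V]
  [DiscreteMeasurableSpace V]

/-- The transition graph of the pull voter model on the complete graph. -/
def PullStep (s s' : V → Opinion) : Prop :=
  CanStep (selectionLaw (⊤ : SimpleGraph V)).toMeasure (fun s q => pull s q.1 q.2) s s'

lemma isHarmonicAt_pull {f : (V → Opinion) → ℝ} {s : V → Opinion}
    (h : ∑ v, ∑ u, (f (pull s v u) - f s) = 0) :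
    IsHarmonicAt (selectionLaw (⊤ : SimpleGraph V)).toMeasure (fun s q => pull s q.1 q.2) f s := by
  have hdrift := integral_selectionLaw_top (f := fun q => f (pull s q.1 q.2) - f s)
    fun v => by simp
  rw [h, mul_zero, integral_sub (integrable_comp_of_finite f _) (integrable_const _),
    integral_const, probReal_univ, one_smul] at hdrift
  exact (sub_eq_zero.1 hdrift).symm

lemma pullStep_pull (s : V → Opinion) {u v : V} (h : v ≠ u) : PullStep s (pull s v u) :=
  ⟨(v, u), selectionLaw_top_singleton_ne_zero h, rfl⟩

lemma reflTransGen_pullStep_const {s : V → Opinion} {u : V} (hu : s u ≠ .agnostic) :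
    ReflTransGen PullStep s (Function.const V (s u)) := by
  suffices ∀ T : Finset V, ReflTransGen PullStep s (T.piecewise (Function.const V (s u)) s) by
    simpa using this Finset.univ
  intro T
  induction T using Finset.induction_on with
  | empty => simp [ReflTransGen.refl]
  | insert v T _ ih =>
    have huT : T.piecewise (Function.const V (s u)) s u = s u := by
      by_cases h : u ∈ T <;> simp [h]
    have hstep : pull (T.piecewise (Function.const V (s u)) s) v u =
        (insert v T).piecewise (Function.const V (s u)) s := by
      rw [pull_of_gnostic (huT.trans_ne hu), huT, Finset.piecewise_insert, Function.const_apply]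
    rw [← hstep]
    rcases eq_or_ne v u with rfl | h
    · rwa [pull_self]
    · exact ih.tail (pullStep_pull _ h)

lemma exists_reflTransGen_pullStep_const (s : V → Opinion) :
    ∃ c, ReflTransGen PullStep s (Function.const V c) := by
  by_cases h : ∃ u, s u ≠ .agnostic
  · obtain ⟨u, hu⟩ := h
    exact ⟨s u, reflTransGen_pullStep_const hu⟩
  · push Not at h
    exact ⟨.agnostic, funext h ▸ .refl⟩

end CompleteGraph

section State

variable {V : Type*} [DecidableEq V] {s : V → Opinion}

lemma state_zero (s : V → Opinion) (ω : ℕ → V × V) : state s ω 0 = s :=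
  rfl

lemma state_const (c : Opinion) (ω : ℕ → V × V) (t : ℕ) :
    state (Function.const V c) ω t = Function.const V c := by
  induction t with
  | zero => rfl
  | succ t ih => rw [state, ih, pull_const]

lemma state_prepend_succ (s : V → Opinion) (q : V × V) (ω : ℕ → V × V) (t : ℕ) :
    state s (prepend q ω) (t + 1) = state (pull s q.1 q.2) ω t := by
  induction t with
  | zero => rfl
  | succ t ih => rw [state, ih, state, prepend]

lemma prepend_mem_becomesRed {w : V} (hw : s w = .agnostic) {q : V × V} {ω : ℕ → V × V} :
    prepend q ω ∈ becomesRed s w ↔ ω ∈ becomesRed (pull s q.1 q.2) w := by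
  simp only [becomesRed, Set.mem_ofPred_eq]
  rw [← Nat.or_exists_add_one]
  simp only [state_zero, hw, reduceCtorEq, false_and, false_or, state_prepend_succ,
    Nat.forall_lt_succ_left, true_and]

lemma prepend_mem_redWins (hs : s ≠ Function.const V .red) {q : V × V} {ω : ℕ → V × V} :
    prepend q ω ∈ redWins s ↔ ω ∈ redWins (pull s q.1 q.2) := by
  have hs' : ¬ ∀ v, s v = .red := fun h => hs (funext h)
  simp only [redWins, Set.mem_ofPred_eq]
  rw [← Nat.or_exists_add_one]
  simp only [state_prepend_succ, state_zero, hs', false_or]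

lemma becomesRed_of_gnostic {w : V} (hw : s w ≠ .agnostic) :
    becomesRed s w = {_ω | s w = .red} := by
  ext ω
  refine ⟨?_, fun h => ⟨0, h, by simp⟩⟩
  rintro ⟨_ | t, ht, hlt⟩
  · exact ht
  · exact absurd (hlt 0 t.succ_pos) hw

lemma becomesRed_const_agnostic (w : V) : becomesRed (Function.const V .agnostic) w = ∅ := by
  simp [becomesRed, state_const]

lemma redWins_const [Nonempty V] (c : Opinion) :
    redWins (Function.const V c) = {_ω | c = .red} := by
  simp [redWins, state_const]

variable [Finite V] [MeasurableSpace V] [DiscreteMeasurableSpace V]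

lemma measurable_state (s : V → Opinion) (t : ℕ) : Measurable fun ω => state s ω t := by
  induction t with
  | zero => exact measurable_const
  | succ t ih =>
    have hpull : Measurable fun x : (V → Opinion) × (V × V) => pull x.1 x.2.1 x.2.2 := .of_discrete
    exact hpull.comp (ih.prodMk (measurable_pi_apply t))

lemma measurableSet_becomesRed (s : V → Opinion) (w : V) : MeasurableSet (becomesRed s w) := by
  have h (t : ℕ) (c : Opinion) : MeasurableSet {ω | state s ω t w = c} :=
    measurable_state s t (.of_discrete (s := {x : V → Opinion | x w = c}))
  have : becomesRed s w =
      ⋃ t, {ω | state s ω t w = .red} ∩ ⋂ i < t, {ω | state s ω i w = .agnostic} := by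
    ext ω; simp [becomesRed]
  rw [this]
  exact .iUnion fun t => (h t _).inter (.iInter fun i => .iInter fun _ => h i _)

lemma measurableSet_redWins (s : V → Opinion) : MeasurableSet (redWins s) := by
  have : redWins s = ⋃ t, {ω | ∀ v, state s ω t v = .red} := by
    ext ω; simp [redWins]
  rw [this]
  exact .iUnion fun t =>
    measurable_state s t (.of_discrete (s := {x : V → Opinion | ∀ v, x v = .red}))

end State

section Main

variable {V : Type*} [Fintype V] [Nonempty V] [MeasurableSpace V]

instance (G : SimpleGraph V) [DecidableRel G.Adj] : IsProbabilityMeasure (asyncMeasure G) :=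
  inferInstanceAs (IsProbabilityMeasure (Measure.infinitePi _))

variable [DecidableEq V] [DiscreteMeasurableSpace V]

theorem asyncMeasure_becomesRed_eq_firstRedProb (s : V → Opinion) (w : V) :
    (asyncMeasure (⊤ : SimpleGraph V)).real (becomesRed s w) = firstRedProb w s := by
  let A : Set (V → Opinion) := {s | s w ≠ .agnostic} ∪ {Function.const V .agnostic}
  have hA (s) : ∃ a ∈ A, ReflTransGen PullStep s a := by
    obtain ⟨c, hc⟩ := exists_reflTransGen_pullStep_const s
    refine ⟨_, ?_, hc⟩
    cases c <;> simp [A]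
  have hagnostic {s} (hs : s ∉ A) : s w = .agnostic := not_not.1 fun h => hs (.inl h)
  refine congrFun (eq_of_isHarmonicAt_of_eqOn
    (f := fun s => (asyncMeasure ⊤).real (becomesRed s w)) hA (fun s hs => ?_) (fun s hs => ?_)
    ?_) s
  · exact isHarmonicAt_infinitePi_real (measurableSet_becomesRed s w)
      fun _ _ => prepend_mem_becomesRed (hagnostic hs)
  · exact isHarmonicAt_pull (sum_sum_firstRedProb_pull (hagnostic hs))
  · rintro s ((hs : s w ≠ .agnostic) | rfl)
    · simp only [becomesRed_of_gnostic hs, firstRedProb, if_neg hs]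
      by_cases h : s w = .red <;> simp [redIndicator, h]
    · simp [becomesRed_const_agnostic, firstRedProb, redFraction_const, redIndicator]

theorem asyncMeasure_redWins (s : V → Opinion) :
    (asyncMeasure (⊤ : SimpleGraph V)).real (redWins s) = redFraction s := by
  have hA (s : V → Opinion) : ∃ a ∈ Set.range (Function.const V), ReflTransGen PullStep s a := by
    obtain ⟨c, hc⟩ := exists_reflTransGen_pullStep_const s
    exact ⟨_, ⟨c, rfl⟩, hc⟩
  refine congrFun (eq_of_isHarmonicAt_of_eqOn
    (f := fun s => (asyncMeasure ⊤).real (redWins s)) hA (fun s hs => ?_) (fun s _ => ?_) ?_) s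
  · exact isHarmonicAt_infinitePi_real (measurableSet_redWins s)
      fun _ _ => prepend_mem_redWins fun h => hs ⟨.red, h.symm⟩
  · exact isHarmonicAt_pull (sum_sum_redFraction_pull s)
  · rintro _ ⟨c, rfl⟩
    cases c <;> simp [redWins_const, redFraction_const, redIndicator]

end Main

end AgnosticVoter

/-- `V` carries the discrete σ-algebra. -/
theorem corollary1 {V : Type*} [Fintype V] [DecidableEq V] [Nonempty V]
    [MeasurableSpace V] [DiscreteMeasurableSpace V]
    (s₀ : V → AgnosticVoter.Opinion)
    (hs₀ : ∃ v, s₀ v ≠ AgnosticVoter.Opinion.agnostic) :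
    (∀ u, s₀ u = AgnosticVoter.Opinion.agnostic →
      (AgnosticVoter.asyncMeasure (⊤ : SimpleGraph V)).real (AgnosticVoter.becomesRed s₀ u) =
        AgnosticVoter.redFraction s₀) ∧
    (AgnosticVoter.asyncMeasure (⊤ : SimpleGraph V)).real (AgnosticVoter.redWins s₀) =
      AgnosticVoter.redFraction s₀ := by
  refine ⟨fun u hu => ?_, AgnosticVoter.asyncMeasure_redWins s₀⟩
  rw [AgnosticVoter.asyncMeasure_becomesRed_eq_firstRedProb, AgnosticVoter.firstRedProb, if_pos hu]
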